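/- Let $k$ be a field, $n\ge 0$, and let $M$ be a matroid on $[n]=\{1,\dots,n\}$ with no loops and no coloops. Let $W\subseteq k^{n}$ be a linear subspace that realizes $M$: for every $B\subseteq[n]$, the coordinate projection $W\to k^{B}$ is an isomorphism if and only if $B$ is a basis of $M$. Let $W^\perp=\{y\in k^n : \sum_i y_iw_i=0 \text{ for all } w\in W\}\cong (k^n/W)^*$. Let $R=k[W]=\operatorname{Sym}(W^*)$ and $R^\perp=k[W^\perp]=\operatorname{Sym}((W^\perp)^*)$ be the coordinate rings, and let $f_i\in R$ and $g_i\in R^\perp$ be the restrictions of the $i$-th coordinate function to $W$ and to $W^\perp$. Let $S=R\otimes_k R^\perp$ with its natural bigrading, let $\mathfrak a=(f_1g_1,\dots,f_ng_n)\subseteq S$ (the ideal of pairs), and let $(S/\mathfrak a)_{(\cdot,1)}$ be the $R$-module $\bigoplus_{i\ge 0}(S/\mathfrak a)_{(i,1)}$, that is, the image of $R\otimes_k (R^\perp)_1$ in $S/\mathfrak a$. For $F\subseteq[n]$ let $P_F=(f_i : i\in F)\subseteq R$. A flat of $M$ is called cyclic if it is a (possibly empty) union of circuits of $M$. Then: (a)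 every associated prime of the $R$-module $(S/\mathfrak a)_{(\cdot,1)}$ is equal to $P_F$ for some nonempty flat $F$ of $M$; (b) the set of minimal primes of the $R$-module $(S/\mathfrak a)_{(\cdot,1)}$ (the primes minimal over its annihilator) is exactly the set of ideals $P_F$ with $F$ a minimal element, under inclusion, of the set of nonempty cyclic flats of $M$. -/

import Mathlib

open scoped TensorProduct

noncomputable section

namespace IdealOfPairs

variable {ι k : Type*} [Fintype ι] [Field k]

/-- A linear subspace `W ⊆ k^ι` is a realization of the matroid `M` on the ground set `ι` if, for
every subset `B`, the composite `W → k^ι → k^B` is an isomorphism if and only if `B` is a basis. -/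
structure IsRealization (M : Matroid ι) (W : Submodule k (ι → k)) : Prop where
  ground_eq : M.E = Set.univ
  isBase_iff : ∀ B : Set ι,
    M.IsBase B ↔ Function.Bijective (fun (w : W) (i : B) => (w : ι → k) i)

/-- `W^⊥ = (k^ι / W)^*`, regarded as a subspace of `k^ι` through the standard coordinates:
the coefficient vectors of the linear forms on `k^ι` that vanish on `W`. -/
def perp (W : Submodule k (ι → k)) : Submodule k (ι → k) where
  carrier := {y | ∀ w ∈ W, ∑ i, y i * w i = 0}
  zero_mem' := by simp
  add_mem' := by
    intro a b ha hb w hw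
    simp only [Pi.add_apply, add_mul, Finset.sum_add_distrib, ha w hw, hb w hw, add_zero]
  smul_mem' := by
    intro c a ha w hw
    simp only [Pi.smul_apply, smul_eq_mul, mul_assoc, ← Finset.mul_sum, ha w hw, mul_zero]

/-- The coordinate ring `k[U] = Sym (U^*)` of a linear subspace `U ⊆ k^ι`, a polynomial ring.
(It is the ring of polynomials on `U`, not of polynomial functions, so `k` may be finite.) -/
abbrev CoordRing (U : Submodule k (ι → k)) : Type _ :=
  SymmetricAlgebra k (Module.Dual k U)

/-- The restriction to `U` of the `i`-th coordinate function of `k^ι`, as an element of `k[U]`.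
For `U = W` this is `f_i`, for `U = W^⊥` it is `g_i`. -/
def coord (U : Submodule k (ι → k)) (i : ι) : CoordRing U :=
  SymmetricAlgebra.ι k (Module.Dual k U) ((LinearMap.proj i : (ι → k) →ₗ[k] k).comp U.subtype)

/-- The homogeneous polynomials of degree `d` on `U`. -/
def homogPart (U : Submodule k (ι → k)) (d : ℕ) : Submodule k (CoordRing U) :=
  LinearMap.range (SymmetricAlgebra.ι k (Module.Dual k U)) ^ d

/-- The bigraded ring `S = R ⊗ R^⊥`, where `R = k[W]` and `R^⊥ = k[W^⊥]`. It is an `R`-algebra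
through the left factor. -/
abbrev BigradedRing (W : Submodule k (ι → k)) : Type _ :=
  CoordRing W ⊗[k] CoordRing (perp W)

/-- The ideal of pairs `𝔞 = (f_i g_i : i ∈ ι)` of `S`. -/
def idealOfPairs (W : Submodule k (ι → k)) : Ideal (BigradedRing W) :=
  Ideal.span (Set.range fun i => coord W i ⊗ₜ[k] coord (perp W) i)

/-- The slice `S_(·,d) = R ⊗ (R^⊥)_d` of `S`, an `R`-submodule of `S`. -/
def slice (W : Submodule k (ι → k)) (d : ℕ) : Submodule (CoordRing W) (BigradedRing W) :=
  (homogPart (perp W) d).baseChange (CoordRing W)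

/-- The slice `(S/𝔞)_(·,d)` of the bigraded ring `S/𝔞`, that is, the image of `S_(·,d)` in `S/𝔞`,
an `R`-submodule of `S/𝔞`. -/
def quotSlice (W : Submodule k (ι → k)) (d : ℕ) :
    Submodule (CoordRing W) (BigradedRing W ⧸ idealOfPairs W) :=
  (slice W d).map (Ideal.Quotient.mkₐ (CoordRing W) (idealOfPairs W)).toLinearMap

/-- The ideal `P_F = (f_i : i ∈ F)` of `R`. -/
def flatIdeal (W : Submodule k (ι → k)) (F : Set ι) : Ideal (CoordRing W) :=
  Ideal.span (coord W '' F)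

/-- A flat is cyclic if it is a (possibly empty) union of circuits. -/
def IsCyclicFlat {α : Type*} (M : Matroid α) (F : Set α) : Prop :=
  M.IsFlat F ∧ ∃ 𝒞 : Set (Set α), (∀ C ∈ 𝒞, M.IsCircuit C) ∧ F = ⋃₀ 𝒞

/-- The minimal primes of a module: the primes that are minimal over its annihilator. For a
finitely generated module these are the minimal elements of its support. -/
def moduleMinimalPrimes (R N : Type*) [CommRing R] [AddCommGroup N] [Module R N] :
    Set (Ideal R) :=
  (Module.annihilator R N).minimalPrimes

end IdealOfPairs

end

/-! ### A presentation of the degree-one slice. -/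

noncomputable section
namespace IdealOfPairs

variable {ι k : Type*} [Field k]

/-! Linear relations among the `g_i` are exactly the vectors of `W`, so sending `e_i` to `g_i`
presents the slice as `R^ι` modulo the constant vectors from `W` and the `f_i e_i` (`cokerEquiv`).
Everything is then read off this cokernel.

Fix a prime `P` and put `F = {i | f_i ∈ P}`, which is a flat. Localizing at `P` kills `e_j` for `j ∉
F`, and what remains vanishes iff `W → k^F` is onto. So the support consists of the `P` with `F`
dependent (`annihilator_le_iff`). A dependent flat contains the closure of a circuit, which is a
cyclic flat; this gives (b).

For (a), let `A` be the subring generated by the `f_i`, `i ∈ F`. Then `R` is a polynomial ring over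
`A`, and once the `f_j` with `j ∉ F` are inverted all relations are defined over `A`. An associated
prime containing the irrelevant ideal of `A` must then be its extension, which is `P_F`
(`mem_map_C_of_smul_mem_extend`, `eq_flatIdeal_of_mem_associatedPrimes`). -/

/-- The restriction to `U` of the `i`-th coordinate function, as a linear form. -/
def form (U : Submodule k (ι → k)) (i : ι) : Module.Dual k U :=
  (LinearMap.proj i : (ι → k) →ₗ[k] k).comp U.subtype

@[simp]
theorem form_apply (U : Submodule k (ι → k)) (i : ι) (u : U) : form U i u = (u : ι → k) i := rfl

theorem coord_eq (U : Submodule k (ι → k)) (i : ι) :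
    coord U i = SymmetricAlgebra.ι k (Module.Dual k U) (form U i) := rfl

section

variable [DecidableEq ι]

/-- The generators of the module of relations between the `g_i` in `(S/𝔞)_(·,1)`. -/
inductive IsRelation (W : Submodule k (ι → k)) : (ι → CoordRing W) → Prop
  | const (w : ι → k) (hw : w ∈ W) : IsRelation W fun i => algebraMap k (CoordRing W) (w i)
  | single (i : ι) : IsRelation W (Pi.single i (coord W i))

/-- The module of relations between the `g_i` in `(S/𝔞)_(·,1)`. -/
def relations (W : Submodule k (ι → k)) : Submodule (CoordRing W) (ι → CoordRing W) :=
  Submodule.span _ {v | IsRelation W v}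

/-- The cokernel `R^ι / (W ⊗ R + (f_i e_i))`, which presents `(S/𝔞)_(·,1)`. -/
abbrev Coker (W : Submodule k (ι → k)) : Type _ := (ι → CoordRing W) ⧸ relations W

theorem const_mem_relations {W : Submodule k (ι → k)} {w : ι → k} (hw : w ∈ W) :
    (fun i => algebraMap k (CoordRing W) (w i)) ∈ relations W :=
  Submodule.subset_span (.const w hw)

theorem single_mem_relations (W : Submodule k (ι → k)) (i : ι) :
    Pi.single i (coord W i) ∈ relations W :=
  Submodule.subset_span (.single i)

/-- The linear map `k^ι → Coker W`. -/
def constToCoker (W : Submodule k (ι → k)) : (ι → k) →ₗ[k] Coker W :=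
  ((relations W).mkQ.restrictScalars k).comp
    (LinearMap.compLeft (Algebra.linearMap k (CoordRing W)) ι)

theorem constToCoker_apply (W : Submodule k (ι → k)) (x : ι → k) :
    constToCoker W x = (relations W).mkQ fun i => algebraMap k (CoordRing W) (x i) := rfl

end

variable [Fintype ι]

theorem sum_smul_form_surjective (U : Submodule k (ι → k)) :
    Function.Surjective (Fintype.linearCombination k (form U)) := by
  classical
  intro φ
  obtain ⟨ψ, hψ⟩ := LinearMap.exists_extend φ
  refine ⟨fun i => ψ (Pi.single i 1), ?_⟩
  ext u
  rw [← hψ, LinearMap.comp_apply, Submodule.subtype_apply, LinearMap.pi_apply_eq_sum_univ ψ,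
    Fintype.linearCombination_apply, LinearMap.sum_apply]
  refine Finset.sum_congr rfl fun i _ => ?_
  simp only [LinearMap.smul_apply, form_apply, smul_eq_mul, mul_comm]
  congr 2
  ext j
  simp [Pi.single_apply, eq_comm]

theorem mem_of_sum_smul_form_perp_eq_zero {W : Submodule k (ι → k)} {x : ι → k}
    (hx : Fintype.linearCombination k (form (perp W)) x = 0) : x ∈ W := by
  classical
  rw [← Subspace.forall_mem_dualAnnihilator_apply_eq_zero_iff W]
  intro φ hφ
  rw [Submodule.mem_dualAnnihilator] at hφ
  have hφ' : ∀ z, φ z = ∑ i, φ (Pi.single i 1) * z i := by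
    intro z
    rw [LinearMap.pi_apply_eq_sum_univ φ]
    refine Finset.sum_congr rfl fun i _ => ?_
    rw [smul_eq_mul, mul_comm]
    congr 2
    ext j
    simp [Pi.single_apply, eq_comm]
  have h := LinearMap.congr_fun hx ⟨fun i => φ (Pi.single i 1), fun w hw => by
    rw [← hφ', hφ w hw]⟩
  rw [hφ']
  simpa [Fintype.linearCombination_apply, mul_comm] using h

theorem sum_smul_form_perp_eq_zero {W : Submodule k (ι → k)} {w : ι → k} (hw : w ∈ W) :
    Fintype.linearCombination k (form (perp W)) w = 0 := by
  ext y
  simpa [Fintype.linearCombination_apply, mul_comm] using y.2 w hw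

variable [DecidableEq ι]

/-- Lifting a form on `W^⊥` to a coefficient vector is ambiguous only by `W`, which is zero in the
cokernel. This map will invert `toQuot` in degree one. -/
theorem exists_dual_perp_to_coker (W : Submodule k (ι → k)) :
    ∃ g : Module.Dual k (perp W) →ₗ[k] Coker W,
      ∀ i, g (form (perp W) i) = (relations W).mkQ (Pi.single i 1) := by
  obtain ⟨s, hs⟩ := (Fintype.linearCombination k (form (perp W))).exists_rightInverse_of_surjective
    (LinearMap.range_eq_top.2 (sum_smul_form_surjective (perp W)))
  refine ⟨(constToCoker W).comp s, fun i => ?_⟩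
  have h1 : s (form (perp W) i) - Pi.single i 1 ∈ W := by
    apply mem_of_sum_smul_form_perp_eq_zero
    rw [map_sub, sub_eq_zero]
    refine (LinearMap.congr_fun hs _).trans ?_
    rw [Fintype.linearCombination_apply_single]
    simp
  have h2 : constToCoker W (s (form (perp W) i) - Pi.single i 1) = 0 := by
    rw [constToCoker_apply, Submodule.mkQ_apply, Submodule.Quotient.mk_eq_zero]
    exact const_mem_relations h1
  rw [map_sub, sub_eq_zero] at h2
  rw [LinearMap.comp_apply, h2, constToCoker_apply]
  congr 1
  ext j
  by_cases h : j = i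
  · subst h; simp
  · simp [h]

/-- The `R`-linear map `R^ι → S/𝔞` that sends `e_i` to the class of `g_i`. -/
def toQuot (W : Submodule k (ι → k)) :
    (ι → CoordRing W) →ₗ[CoordRing W] (BigradedRing W ⧸ idealOfPairs W) :=
  (Ideal.Quotient.mkₐ (CoordRing W) (idealOfPairs W)).toLinearMap.comp
    (Fintype.linearCombination (CoordRing W)
      fun i => (1 : CoordRing W) ⊗ₜ[k] coord (perp W) i)

theorem relations_le_ker_toQuot (W : Submodule k (ι → k)) :
    relations W ≤ LinearMap.ker (toQuot W) := by
  rw [relations, Submodule.span_le]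
  rintro _ (⟨w, hw⟩ | i)
  · have h : Fintype.linearCombination (CoordRing W)
        (fun i => (1 : CoordRing W) ⊗ₜ[k] coord (perp W) i)
        (fun i => algebraMap k (CoordRing W) (w i)) = 0 := by
      have h1 := congrArg (fun φ => (1 : CoordRing W) ⊗ₜ[k]
        SymmetricAlgebra.ι k (Module.Dual k (perp W)) φ) (sum_smul_form_perp_eq_zero hw)
      simpa [Fintype.linearCombination_apply, TensorProduct.tmul_sum, coord_eq] using h1
    rw [SetLike.mem_coe, LinearMap.mem_ker, toQuot, LinearMap.comp_apply, h, map_zero]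
  · rw [SetLike.mem_coe, LinearMap.mem_ker, toQuot, LinearMap.comp_apply,
      Fintype.linearCombination_apply_single, TensorProduct.smul_tmul', smul_eq_mul, mul_one]
    exact Ideal.Quotient.eq_zero_iff_mem.2 (Ideal.subset_span ⟨i, rfl⟩)

/-- The projection of `R ⊗ Sym V` to its part of degree one, followed by a linear map. -/
theorem exists_linearPart (R : Type*) {V Q : Type*} [CommRing R] [Algebra k R]
    [AddCommGroup V] [Module k V] [AddCommGroup Q] [Module R Q] [Module k Q] [IsScalarTower k R Q]
    (g : V →ₗ[k] Q) :
    ∃ (π : R ⊗[k] SymmetricAlgebra k V →ₗ[R] Q) (ε : R ⊗[k] SymmetricAlgebra k V →ₐ[R] R),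
      ∀ s r v, π (s * r ⊗ₜ SymmetricAlgebra.ι k V v) = ε s • r • g v := by
  -- The square-zero extension asks for a right action; by commutativity the left one serves.
  let _ : Module Rᵐᵒᵖ Q := Module.compHom Q ((RingHom.id R).fromOpposite fun _ _ => Commute.all _ _)
  have : IsCentralScalar R Q := ⟨fun _ _ => rfl⟩
  have : IsScalarTower k Rᵐᵒᵖ Q := ⟨fun c r q => smul_assoc c r.unop q⟩
  -- With `v ↦ (0, g v)`, products of two elements of `V` die, so the second component sees only
  -- degree one and the first only degree zero.
  let Φ : R ⊗[k] SymmetricAlgebra k V →ₐ[R] TrivSqZeroExt R Q :=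
    Algebra.TensorProduct.lift (Algebra.ofId _ _)
      (SymmetricAlgebra.lift ((TrivSqZeroExt.inrHom R Q).restrictScalars k ∘ₗ g))
      fun _ _ => Commute.all _ _
  have hΦ : ∀ r v, Φ (r ⊗ₜ SymmetricAlgebra.ι k V v) = TrivSqZeroExt.inr (r • g v) := by
    intro r v
    rw [Algebra.TensorProduct.lift_tmul, SymmetricAlgebra.lift_ι_apply, Algebra.ofId_apply,
      ← Algebra.smul_def]
    simp
  refine ⟨TrivSqZeroExt.sndHom R Q ∘ₗ Φ.toLinearMap, (TrivSqZeroExt.fstHom R R Q).comp Φ,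
    fun s r v => ?_⟩
  change (Φ (s * _)).snd = (Φ s).fst • _
  rw [map_mul, hΦ, TrivSqZeroExt.snd_mul]
  simp

theorem ker_toQuot_le_relations (W : Submodule k (ι → k)) :
    LinearMap.ker (toQuot W) ≤ relations W := by
  obtain ⟨g, hg⟩ := exists_dual_perp_to_coker W
  obtain ⟨π, ε, hπ⟩ := exists_linearPart (CoordRing W) g
  have hπ1 : ∀ r i, π (r ⊗ₜ coord (perp W) i) = (relations W).mkQ (Pi.single i r) := by
    intro r i
    have h := hπ 1 r (form (perp W) i)
    rw [one_mul, map_one, one_smul, hg, ← map_smul, ← Pi.single_smul, smul_eq_mul, mul_one] at h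
    exact h
  -- The multiplier `s` is quantified inside so that the induction passes through ideal multiples.
  have ha : ∀ x ∈ idealOfPairs W, ∀ s, π (s * x) = 0 := by
    intro x hx
    rw [idealOfPairs] at hx
    induction hx using Submodule.span_induction with
    | mem x hx =>
      obtain ⟨i, rfl⟩ := hx
      intro s
      refine (hπ s _ (form (perp W) i)).trans ?_
      rw [hg, ← map_smul (relations W).mkQ, ← Pi.single_smul, smul_eq_mul, mul_one,
        Submodule.mkQ_apply, (Submodule.Quotient.mk_eq_zero _).2 (single_mem_relations W i),
        smul_zero]
    | zero => intro s; rw [mul_zero, map_zero]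
    | add x y _ _ hx hy => intro s; rw [mul_add, map_add, hx, hy, add_zero]
    | smul c x _ hx => intro s; rw [smul_eq_mul, ← mul_assoc, hx]
  intro h hh
  have h1 := ha _ (Ideal.Quotient.eq_zero_iff_mem.1 hh) 1
  rw [one_mul, Fintype.linearCombination_apply, map_sum] at h1
  simp only [TensorProduct.smul_tmul', smul_eq_mul, mul_one, hπ1] at h1
  rw [← map_sum, Finset.univ_sum_single] at h1
  exact (Submodule.Quotient.mk_eq_zero _).1 h1

theorem range_toQuot (W : Submodule k (ι → k)) :
    LinearMap.range (toQuot W) = quotSlice W 1 := by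
  rw [toQuot, LinearMap.range_comp, quotSlice]
  congr 1
  have h : LinearMap.range (SymmetricAlgebra.ι k (Module.Dual k (perp W))) =
      Submodule.span k (Set.range (coord (perp W))) := by
    rw [LinearMap.range_eq_map,
      ← LinearMap.range_eq_top.2 (sum_smul_form_surjective (perp W)),
      Fintype.range_linearCombination, Submodule.map_span, ← Set.range_comp]
    rfl
  rw [Fintype.range_linearCombination, slice, homogPart, pow_one, h, Submodule.baseChange_span,
    ← Set.range_comp]
  rfl

/-- The presentation of the `R`-module `(S/𝔞)_(·,1)` as a cokernel. -/
def cokerEquiv (W : Submodule k (ι → k)) : Coker W ≃ₗ[CoordRing W] quotSlice W 1 :=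
  (Submodule.quotEquivOfEq _ _
    (le_antisymm (relations_le_ker_toQuot W) (ker_toQuot_le_relations W))).trans
    ((toQuot W).quotKerEquivRange.trans (LinearEquiv.ofEq _ _ (range_toQuot W)))

end IdealOfPairs
end

/-! ### Linear forms, flats and cyclic flats. -/

noncomputable section
namespace IdealOfPairs

variable {ι k : Type*} [Fintype ι] [Field k]

/-- By duality: the transpose of the projection sends the coordinate functionals to the forms, so a
kernel element is a linear dependence. -/
theorem surjective_of_linearIndepOn {W : Submodule k (ι → k)} {B : Set ι}
    (hB : LinearIndepOn k (form W) B) :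
    Function.Surjective (fun (w : W) (i : B) => (w : ι → k) i) := by
  classical
  let T : W →ₗ[k] (B → k) := LinearMap.pi fun i : B => form W i
  change Function.Surjective T
  rw [← LinearMap.dualMap_injective_iff, injective_iff_map_eq_zero]
  intro φ hφ
  have h1 : ∑ i : B, φ (Pi.single i 1) • form W i = 0 := by
    rw [← hφ]
    ext w
    rw [LinearMap.dualMap_apply, LinearMap.pi_apply_eq_sum_univ φ, LinearMap.sum_apply]
    refine Finset.sum_congr rfl fun i _ => ?_
    simp only [LinearMap.smul_apply, form_apply, smul_eq_mul, T, LinearMap.pi_apply, mul_comm]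
    congr 2
    ext j
    simp [Pi.single_apply, eq_comm]
  have h2 := Fintype.linearIndependent_iff.1 hB _ h1
  ext i
  simpa using h2 i

namespace IsRealization

variable {M : Matroid ι} {W : Submodule k (ι → k)}

/-- The basis of `W^*` given by the coordinates in a basis of the matroid. -/
def dualBasis (hW : IsRealization M W) {B : Set ι} (hB : M.IsBase B) :
    Module.Basis B k (Module.Dual k W) := by
  classical
  exact (Module.Basis.ofEquivFun (LinearEquiv.ofBijective
    (LinearMap.pi fun i : B => form W i) ((hW.isBase_iff B).1 hB))).dualBasis

theorem dualBasis_apply (hW : IsRealization M W) {B : Set ι} (hB : M.IsBase B) (i : B) :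
    hW.dualBasis hB i = form W i := by
  classical
  ext w
  rw [dualBasis, Module.Basis.coe_dualBasis, Module.Basis.coord_apply,
    Module.Basis.ofEquivFun_repr_apply]
  rfl

theorem indep_iff (hW : IsRealization M W) {I : Set ι} :
    M.Indep I ↔ LinearIndepOn k (form W) I := by
  constructor
  · intro hI
    obtain ⟨B, hB, hIB⟩ := hI.exists_isBase_superset
    suffices h : LinearIndepOn k (form W) B from h.mono hIB
    have h := (hW.dualBasis hB).linearIndependent
    rwa [show ⇑(hW.dualBasis hB) = fun i : B => form W i from
      funext fun i => hW.dualBasis_apply hB i] at h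
  · intro hI
    -- The forms in `B` span all coordinate forms, so a point of `W` is determined by its
    -- `B`-coordinates.
    obtain ⟨B, -, hIB, hspan, hB⟩ := exists_linearIndepOn_extension hI (Set.subset_univ I)
    refine Matroid.IsBase.indep ((hW.isBase_iff B).2 ⟨?_, surjective_of_linearIndepOn hB⟩)
      |>.subset hIB
    intro w w' h
    have h1 : ∀ φ ∈ Submodule.span k (form W '' B), φ w = φ w' := by
      intro φ hφ
      induction hφ using Submodule.span_induction with
      | mem x hx => obtain ⟨i, hi, rfl⟩ := hx; exact congrFun h ⟨i, hi⟩
      | zero => rfl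
      | add x y _ _ hx hy => simp only [LinearMap.add_apply, hx, hy]
      | smul c x _ hx => simp only [LinearMap.smul_apply, hx]
    ext i
    exact h1 _ (hspan ⟨i, Set.mem_univ i, rfl⟩)

theorem mem_closure_iff (hW : IsRealization M W) {F : Set ι} {j : ι} :
    j ∈ M.closure F ↔ form W j ∈ Submodule.span k (form W '' F) := by
  have key : ∀ {I : Set ι}, M.Indep I → ∀ {j}, j ∈ M.closure I ↔
      form W j ∈ Submodule.span k (form W '' I) := by
    intro I hI j
    rw [hI.mem_closure_iff', hW.indep_iff, hW.ground_eq, (hW.indep_iff.1 hI).mem_span_iff]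
    simp
  obtain ⟨I, hI⟩ := M.exists_isBasis F (by simp [hW.ground_eq])
  rw [← hI.closure_eq_closure, key hI.indep]
  suffices h : Submodule.span k (form W '' I) = Submodule.span k (form W '' F) by rw [h]
  refine le_antisymm (Submodule.span_mono (Set.image_mono hI.subset)) ?_
  rw [Submodule.span_le]
  rintro _ ⟨i, hi, rfl⟩
  exact (key hI.indep).1 (hI.subset_closure hi)

/-- The linear forms lying in `P` form a subspace, and matroid closure is linear span. -/
theorem isFlat_setOf_coord_mem (hW : IsRealization M W) (P : Ideal (CoordRing W)) :
    M.IsFlat {i | coord W i ∈ P} := by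
  rw [Matroid.isFlat_iff_closure_eq]
  refine subset_antisymm (fun j hj => ?_) (M.subset_closure _ (by simp [hW.ground_eq]))
  rw [hW.mem_closure_iff] at hj
  have : Submodule.span k (form W '' {i | coord W i ∈ P}) ≤
      (P.restrictScalars k).comap (SymmetricAlgebra.ι k (Module.Dual k W)) := by
    rw [Submodule.span_le]
    rintro _ ⟨i, hi, rfl⟩
    exact hi
  exact this hj

theorem coord_mem_flatIdeal_iff (hW : IsRealization M W) {F : Set ι} (hF : M.IsFlat F) {j : ι} :
    coord W j ∈ flatIdeal W F ↔ j ∈ F := by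
  refine ⟨fun h => ?_, fun h => Ideal.subset_span ⟨j, h, rfl⟩⟩
  rw [← hF.closure, hW.mem_closure_iff]
  by_contra hj
  obtain ⟨x, hx1, hx2⟩ : ∃ x : W, (∀ φ ∈ Submodule.span k (form W '' F), φ x = 0) ∧
      form W j x ≠ 0 := by
    by_contra! H
    apply hj
    rw [← Subspace.dualCoannihilator_dualAnnihilator_eq (W := Submodule.span k (form W '' F)),
      Submodule.mem_dualAnnihilator]
    intro x hx
    exact H x fun φ hφ => (Submodule.mem_dualCoannihilator _).1 hx φ hφ
  -- Evaluation at a point of `W` where all `f_i`, `i ∈ F`, vanish but `f_j` does not.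
  let ev : CoordRing W →ₐ[k] k := SymmetricAlgebra.lift (Module.Dual.eval k W x)
  have hev : ∀ i, ev (coord W i) = form W i x := fun i => by
    rw [coord_eq, SymmetricAlgebra.lift_ι_apply, Module.Dual.eval_apply]
  have hle : flatIdeal W F ≤ RingHom.ker ev := by
    rw [flatIdeal, Ideal.span_le]
    rintro _ ⟨i, hi, rfl⟩
    rw [SetLike.mem_coe, RingHom.mem_ker]
    exact (hev i).trans (hx1 _ (Submodule.subset_span ⟨i, hi, rfl⟩))
  exact hx2 ((hev j).symm.trans (hle h))

theorem setOf_coord_mem_flatIdeal (hW : IsRealization M W) {F : Set ι} (hF : M.IsFlat F) :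
    {i | coord W i ∈ flatIdeal W F} = F :=
  Set.ext fun _ => hW.coord_mem_flatIdeal_iff hF

end IsRealization

theorem isCyclicFlat_closure {α : Type*} {M : Matroid α} {C : Set α} (hC : M.IsCircuit C) :
    IsCyclicFlat M (M.closure C) := by
  refine ⟨M.isFlat_closure C, {D | M.IsCircuit D ∧ D ⊆ M.closure C}, fun D hD => hD.1,
    subset_antisymm (fun e he => ?_) (Set.sUnion_subset fun D hD => hD.2)⟩
  by_cases heC : e ∈ C
  · exact ⟨C, ⟨hC, M.subset_closure C hC.subset_ground⟩, heC⟩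
  · obtain ⟨D, hDC, hD, heD⟩ := Matroid.exists_isCircuit_of_mem_closure he heC
    exact ⟨D, ⟨hD, hDC.trans (Set.insert_subset he (M.subset_closure C hC.subset_ground))⟩, heD⟩

theorem IsCyclicFlat.dep {α : Type*} {M : Matroid α} {F : Set α} (hF : IsCyclicFlat M F)
    (hne : F.Nonempty) : M.Dep F := by
  obtain ⟨hflat, 𝒞, h𝒞, rfl⟩ := hF
  obtain ⟨x, C, hC, -⟩ := hne
  exact (h𝒞 C hC).dep.superset (Set.subset_sUnion_of_mem hC) hflat.subset_ground

end IdealOfPairs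
end

/-! ### Modules extended to polynomial rings, and primality of `P_F`. -/

noncomputable section
namespace IdealOfPairs

open MvPolynomial

section Coefficients

variable {A B ι τ : Type*} [CommRing A] [CommRing B]

/-- The extension to `B ≃ A[τ]` of a submodule of `A^ι`. -/
def extend (e : B ≃+* MvPolynomial τ A) (L : Submodule A (ι → A)) : Submodule B (ι → B) :=
  Submodule.span B ((fun (z : ι → A) i => e.symm (C (z i))) '' L)

theorem coeff_mem_of_mem_extend {e : B ≃+* MvPolynomial τ A} {L : Submodule A (ι → A)} {x : ι → B}
    (hx : x ∈ extend e L) (α : τ →₀ ℕ) : (fun i => coeff α (e (x i))) ∈ L := by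
  classical
  rw [extend] at hx
  induction hx using Submodule.span_induction generalizing α with
  | mem x hx =>
    obtain ⟨z, hz, rfl⟩ := hx
    simp only [RingEquiv.apply_symm_apply, coeff_C]
    split_ifs
    · exact hz
    · exact L.zero_mem
  | zero =>
    simp only [Pi.zero_apply, map_zero, coeff_zero]
    exact L.zero_mem
  | add x y _ _ hx hy => simpa using! L.add_mem (hx α) (hy α)
  | smul b x _ hx =>
    have h : (fun i => coeff α (e ((b • x) i))) =
        ∑ p ∈ Finset.HasAntidiagonal.antidiagonal α, coeff p.1 (e b) • fun i => coeff p.2 (e (x i)) := by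
      ext i
      simp [coeff_mul]
    rw [h]
    exact L.sum_mem fun p _ => L.smul_mem _ (hx p.2)

theorem mem_extend_of_coeff_mem [Finite ι] {e : B ≃+* MvPolynomial τ A} {L : Submodule A (ι → A)}
    {x : ι → B} (hx : ∀ α, (fun i => coeff α (e (x i))) ∈ L) : x ∈ extend e L := by
  classical
  have := Fintype.ofFinite ι
  have h : x = ∑ α ∈ Finset.univ.biUnion fun i => (e (x i)).support,
      e.symm (monomial α 1) • fun i => e.symm (C (coeff α (e (x i)))) := by
    ext i
    apply e.injective
    rw [Finset.sum_apply, map_sum]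
    simp only [Pi.smul_apply, smul_eq_mul, map_mul, RingEquiv.apply_symm_apply, mul_comm _ (C _),
      C_mul_monomial, mul_one]
    conv_lhs => rw [(e (x i)).as_sum]
    refine Finset.sum_subset (Finset.subset_biUnion_of_mem (fun i => (e (x i)).support)
      (Finset.mem_univ i)) fun α _ hα => ?_
    rw [notMem_support_iff.1 hα, monomial_zero]
  rw [h]
  exact Submodule.sum_mem _ fun α _ => Submodule.smul_mem _ _
    (Submodule.subset_span ⟨_, hx α, rfl⟩)

/-- If an element of `B^ι`, where `B ≃ A[τ]`, is killed by a maximal ideal `𝔫` of `A` modulo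
a submodule extended from `A^ι`, then its annihilator is contained in `𝔫B`. -/
theorem mem_map_C_of_smul_mem_extend [Finite ι] [LinearOrder τ] [WellFoundedGT τ]
    (e : B ≃+* MvPolynomial τ A) (𝔫 : Ideal A) [h𝔫 : 𝔫.IsMaximal] (L : Submodule A (ι → A))
    {v : ι → B} (hv : v ∉ extend e L) (hn : ∀ a ∈ 𝔫, e.symm (C a) • v ∈ extend e L)
    {b : B} (hb : b • v ∈ extend e L) : e b ∈ 𝔫.map C := by
  classical
  have := Fintype.ofFinite ι
  rw [mem_map_C_iff]
  by_contra! hα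
  let c : (τ →₀ ℕ) → ι → A := fun β i => coeff β (e (v i))
  obtain ⟨β₀, hβ₀⟩ : ∃ β, c β ∉ L := by
    by_contra! H
    exact hv (mem_extend_of_coeff_mem H)
  have hnc : ∀ a ∈ 𝔫, ∀ β, a • c β ∈ L := by
    intro a ha β
    convert! coeff_mem_of_mem_extend (hn a ha) β using 2 with i
    simp [c]
  -- A Gauss-lemma argument: take `β` largest with the coefficient of `v` outside `L` and `α`
  -- largest with the coefficient of `e b` outside `𝔫`. In degree `α + β` every other product lies
  -- in `L`, hence so does this one; but the scalar is invertible modulo `𝔫`, and `𝔫` already sends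
  -- the vector into `L`.
  let m : MonomialOrder τ := MonomialOrder.lex
  obtain ⟨β, hβ, hβmax⟩ := Finset.exists_max_image
    ((Finset.univ.biUnion fun i => (e (v i)).support).filter fun β => c β ∉ L) m.toSyn <| by
      refine ⟨β₀, Finset.mem_filter.2 ⟨?_, hβ₀⟩⟩
      by_contra hmem
      apply hβ₀
      convert! L.zero_mem
      ext i
      simp only [Finset.mem_biUnion, Finset.mem_univ, true_and, not_exists] at hmem
      exact notMem_support_iff.1 (hmem i)
  obtain ⟨α₀, hα₀⟩ := hα
  obtain ⟨α, hα, hαmax⟩ := Finset.exists_max_image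
    ((e b).support.filter fun α => coeff α (e b) ∉ 𝔫) m.toSyn
    ⟨α₀, Finset.mem_filter.2 ⟨mem_support_iff.2 fun h => hα₀ (h ▸ 𝔫.zero_mem), hα₀⟩⟩
  have hαn := (Finset.mem_filter.1 hα).2
  have hβL := (Finset.mem_filter.1 hβ).2
  have hsum : ∑ p ∈ Finset.HasAntidiagonal.antidiagonal (α + β), coeff p.1 (e b) • c p.2 ∈ L := by
    convert! coeff_mem_of_mem_extend hb (α + β) using 2 with i
    simp [coeff_mul, c]
  have hlead : coeff α (e b) • c β ∈ L := by
    rw [← Finset.add_sum_erase _ _ (Finset.HasAntidiagonal.mem_antidiagonal.2 rfl : (α, β) ∈ _)] at hsum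
    refine (Submodule.add_mem_iff_left _ (L.sum_mem fun p hp => ?_)).1 hsum
    obtain ⟨hne, hp⟩ := Finset.mem_erase.1 hp
    rw [Finset.HasAntidiagonal.mem_antidiagonal] at hp
    by_contra hcon
    have h1 : m.toSyn p.1 ≤ m.toSyn α := by
      refine hαmax _ (Finset.mem_filter.2 ⟨mem_support_iff.2 fun h => hcon ?_, fun h => hcon ?_⟩)
      · rw [h, zero_smul]; exact L.zero_mem
      · exact hnc _ h _
    have h2 : m.toSyn p.2 ≤ m.toSyn β := by
      have hp2 : c p.2 ∉ L := fun h => hcon (L.smul_mem _ h)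
      refine hβmax _ (Finset.mem_filter.2 ⟨?_, hp2⟩)
      by_contra hmem
      apply hp2
      convert! L.zero_mem
      ext i
      simp only [Finset.mem_biUnion, Finset.mem_univ, true_and, not_exists] at hmem
      exact notMem_support_iff.1 (hmem i)
    have h3 : m.toSyn p.1 + m.toSyn p.2 = m.toSyn α + m.toSyn β := by
      rw [← map_add, ← map_add, hp]
    have h4 : m.toSyn p.1 = m.toSyn α :=
      h1.antisymm (le_of_add_le_add_right (h3.symm.le.trans (add_le_add_right h2 _)))
    rw [h4, add_right_inj] at h3
    exact hne (Prod.ext (m.toSyn.injective h4) (m.toSyn.injective h3))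
  obtain ⟨y, i, hi, hy⟩ := h𝔫.exists_inv hαn
  apply hβL
  rw [← one_smul A (c β), ← hy, add_smul, mul_smul]
  exact L.add_mem (L.smul_mem _ hlead) (hnc _ hi _)

end Coefficients

theorem idealOfVars_eq_ker (σ k : Type*) [CommRing k] :
    idealOfVars σ k = RingHom.ker (constantCoeff : MvPolynomial σ k →+* k) := by
  ext p
  rw [← pow_one (idealOfVars σ k), mem_pow_idealOfVars_iff', RingHom.mem_ker]
  simp only [Nat.lt_one_iff, Finsupp.degree_eq_zero_iff, forall_eq]
  rfl

instance isMaximal_idealOfVars (σ k : Type*) [Field k] : (idealOfVars σ k).IsMaximal := by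
  rw [idealOfVars_eq_ker]
  exact RingHom.ker_isMaximal_of_surjective _ fun x => ⟨C x, constantCoeff_C _ x⟩

variable {ι k : Type*} [Field k] {M : Matroid ι} {W : Submodule k (ι → k)}

theorem flatIdeal_eq_comap {F I T : Set ι} (hIF : I ⊆ F)
    {e : CoordRing W ≃ₐ[k] MvPolynomial T (MvPolynomial I k)}
    (he : ∀ i : I, e (coord W i) = C (X i))
    (heF : ∀ i ∈ F, ∃ l ∈ idealOfVars I k, e (coord W i) = C l) :
    flatIdeal W F = ((idealOfVars I k).map C).comap e := by
  apply le_antisymm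
  · rw [flatIdeal, Ideal.span_le]
    rintro _ ⟨i, hi, rfl⟩
    obtain ⟨l, hl, h⟩ := heF i hi
    rw [SetLike.mem_coe, Ideal.mem_comap, h]
    exact Ideal.mem_map_of_mem _ hl
  · have h : (idealOfVars I k).map C ≤ (flatIdeal W F).comap e.symm := by
      rw [Ideal.map_span, Ideal.span_le]
      rintro _ ⟨_, ⟨i, rfl⟩, rfl⟩
      rw [SetLike.mem_coe, Ideal.mem_comap, ← he, AlgEquiv.symm_apply_apply]
      exact Ideal.subset_span ⟨i, hIF i.2, rfl⟩
    intro x hx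
    simpa using h hx

theorem flatIdeal_le_iff {P : Ideal (CoordRing W)} {F : Set ι} :
    flatIdeal W F ≤ P ↔ F ⊆ {i | coord W i ∈ P} := by
  rw [flatIdeal, Ideal.span_le, Set.image_subset_iff]
  rfl

variable [Fintype ι]

namespace IsRealization

/-- `k[W]` is a polynomial ring over the polynomial ring generated by the `f_i` with `i ∈ F`. -/
theorem exists_polynomial_equiv (hW : IsRealization M W) (F : Set ι) :
    ∃ I T : Set ι, I ⊆ F ∧ ∃ e : CoordRing W ≃ₐ[k] MvPolynomial T (MvPolynomial I k),
      (∀ i : I, e (coord W i) = C (X i)) ∧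
        ∀ i ∈ F, ∃ l ∈ idealOfVars I k, e (coord W i) = C l := by
  classical
  obtain ⟨I, hI⟩ := M.exists_isBasis F (by simp [hW.ground_eq])
  obtain ⟨B, hB, hIB⟩ := hI.indep.exists_isBase_superset
  -- The summands are swapped because `sumAlgEquiv` puts the right-hand variables into the
  -- coefficients.
  let E : B ≃ (B \ I : Set ι) ⊕ I := (Equiv.Set.sumDiffSubset hIB).symm.trans (Equiv.sumComm _ _)
  let e : CoordRing W ≃ₐ[k] MvPolynomial (B \ I : Set ι) (MvPolynomial I k) :=
    (SymmetricAlgebra.equivMvPolynomial ((hW.dualBasis hB).reindex E)).trans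
      (sumAlgEquiv k _ _)
  have he : ∀ i : I, e (coord W i) = C (X i) := by
    intro i
    have h1 : form W i = ((hW.dualBasis hB).reindex E) (Sum.inr i) := by
      rw [Module.Basis.reindex_apply, hW.dualBasis_apply]
      rfl
    rw [coord_eq, h1]
    simp only [e, AlgEquiv.trans_apply, SymmetricAlgebra.equivMvPolynomial_ι_apply,
      sumAlgEquiv_X_inr]
  refine ⟨I, B \ I, hI.subset, e, he, fun i hi => ?_⟩
  have hspan : form W i ∈ Submodule.span k (form W '' I) := by
    rw [← hW.mem_closure_iff]
    exact hI.subset_closure hi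
  rw [coord_eq]
  generalize form W i = φ at hspan
  induction hspan using Submodule.span_induction with
  | mem x hx =>
    obtain ⟨j, hj, rfl⟩ := hx
    exact ⟨X ⟨j, hj⟩, Ideal.subset_span ⟨_, rfl⟩, he ⟨j, hj⟩⟩
  | zero => exact ⟨0, Ideal.zero_mem _, by simp⟩
  | add x y _ _ hx hy =>
    obtain ⟨l, hl, hx⟩ := hx
    obtain ⟨l', hl', hy⟩ := hy
    exact ⟨l + l', Ideal.add_mem _ hl hl', by simp [hx, hy]⟩
  | smul a x _ hx =>
    obtain ⟨l, hl, hx⟩ := hx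
    refine ⟨a • l, Submodule.smul_of_tower_mem _ a hl, ?_⟩
    rw [map_smul, map_smul, hx]
    exact (map_smul (IsScalarTower.toAlgHom k (MvPolynomial I k) _) a l).symm

theorem isPrime_flatIdeal (hW : IsRealization M W) (F : Set ι) : (flatIdeal W F).IsPrime := by
  obtain ⟨I, T, hIF, e, he, heF⟩ := hW.exists_polynomial_equiv F
  rw [flatIdeal_eq_comap hIF he heF]
  have : ((idealOfVars I k).map (C : _ →+* MvPolynomial T (MvPolynomial I k))).IsPrime := by
    rw [idealOfVars_eq_ker, ← ker_map]
    exact RingHom.ker_isPrime _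
  exact Ideal.comap_isPrime _ _

theorem isNoetherianRing (hW : IsRealization M W) : IsNoetherianRing (CoordRing W) := by
  obtain ⟨I, T, -, e, -⟩ := hW.exists_polynomial_equiv ∅
  exact isNoetherianRing_of_ringEquiv _ e.symm.toRingEquiv

end IsRealization

end IdealOfPairs
end

/-! ### Support, associated primes and minimal primes of the cokernel. -/

noncomputable section
namespace IdealOfPairs

open MvPolynomial

variable {ι k : Type*} [Fintype ι] [DecidableEq ι] [Field k] {M : Matroid ι}
  {W : Submodule k (ι → k)}

/-- The product of all `f_j ∉ P` replaces localization at `P`: one denominator kills every such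
`e_j`. -/
theorem exists_notMem_single_mem_relations (P : Ideal (CoordRing W)) [hP : P.IsPrime] :
    ∃ u ∉ P, ∀ j, coord W j ∉ P → Pi.single j u ∈ relations W := by
  classical
  refine ⟨∏ j with coord W j ∉ P, coord W j, ?_, fun j hj => ?_⟩
  · rw [hP.prod_mem_iff]
    simp
  · rw [← Finset.prod_erase_mul _ _ (Finset.mem_filter.2 ⟨Finset.mem_univ j, hj⟩),
      ← smul_eq_mul, Pi.single_smul]
    exact Submodule.smul_mem _ _ (single_mem_relations W j)

theorem mem_annihilator_coker {u : CoordRing W} (hu : ∀ i, Pi.single i u ∈ relations W) :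
    u ∈ Module.annihilator (CoordRing W) (Coker W) := by
  rw [Module.mem_annihilator]
  intro x
  obtain ⟨v, rfl⟩ := (relations W).mkQ_surjective x
  rw [← map_smul, Submodule.mkQ_apply, Submodule.Quotient.mk_eq_zero,
    ← Finset.univ_sum_single (u • v)]
  refine Submodule.sum_mem _ fun i _ => ?_
  rw [Pi.smul_apply, smul_eq_mul, mul_comm, ← smul_eq_mul, Pi.single_smul]
  exact Submodule.smul_mem _ _ (hu i)

namespace IsRealization

theorem not_annihilator_le (hW : IsRealization M W) {P : Ideal (CoordRing W)} [P.IsPrime]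
    (hI : M.Indep {i | coord W i ∈ P}) :
    ¬ Module.annihilator (CoordRing W) (Coker W) ≤ P := by
  classical
  intro hle
  obtain ⟨u, huP, hu⟩ := exists_notMem_single_mem_relations P
  refine huP (hle (mem_annihilator_coker fun i => ?_))
  by_cases hi : coord W i ∈ P
  · obtain ⟨w, hw⟩ := surjective_of_linearIndepOn (hW.indep_iff.1 hI) (Pi.single ⟨i, hi⟩ 1)
    -- Here `w ∈ W` agrees with `e_i` on the indices with `f_j ∈ P`; its other entries are cleared
    -- by `u`.
    have h : Pi.single i u = u • (fun j => algebraMap k (CoordRing W) ((w : ι → k) j)) -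
        ∑ j with coord W j ∉ P, algebraMap k (CoordRing W) ((w : ι → k) j) • Pi.single j u := by
      ext j
      rw [Pi.sub_apply, Finset.sum_apply]
      simp only [Pi.smul_apply, Pi.single_apply, smul_eq_mul, mul_ite, mul_zero,
        Finset.sum_ite_eq, Finset.mem_filter, Finset.mem_univ, true_and]
      by_cases hj : coord W j ∈ P
      · have h1 : (w : ι → k) j = if j = i then 1 else 0 := by
          have := congrFun hw ⟨j, hj⟩
          simpa [Pi.single_apply] using this
        rw [h1]
        split_ifs <;> simp_all
      · have : j ≠ i := fun h => hj (h ▸ hi)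
        simp [hj, this, mul_comm]
    rw [h]
    refine Submodule.sub_mem _ (Submodule.smul_mem _ _ (const_mem_relations w.2))
      (Submodule.sum_mem _ fun j hj => Submodule.smul_mem _ _ (hu j (Finset.mem_filter.1 hj).2))
  · exact hu i hi

theorem annihilator_le (hW : IsRealization M W) {P : Ideal (CoordRing W)} [hP : P.IsPrime]
    (hI : ¬ M.Indep {i | coord W i ∈ P}) :
    Module.annihilator (CoordRing W) (Coker W) ≤ P := by
  classical
  rw [hW.indep_iff, LinearIndepOn, Fintype.not_linearIndependent_iff] at hI
  obtain ⟨y, hy, i₀, hi₀⟩ := hI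
  -- Pairing with the dependence `y` kills `W` and sends each `f_i e_i` into `P`. It induces a map
  -- from the cokernel to `R/P` taking `e_{i₀}` to a unit.
  let ψ : (ι → CoordRing W) →ₗ[CoordRing W] CoordRing W :=
    ∑ i, algebraMap k (CoordRing W) (y i) • LinearMap.proj (i : ι)
  have hψ : ∀ x, ψ x = ∑ i, algebraMap k (CoordRing W) (y i) * x i := fun x => by
    simp [ψ, LinearMap.sum_apply, Algebra.smul_def]
  have hle : relations W ≤ Submodule.comap ψ P := by
    rw [relations, Submodule.span_le]
    rintro _ (⟨w, hw⟩ | j)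
    · have h := LinearMap.congr_fun hy ⟨w, hw⟩
      rw [LinearMap.sum_apply] at h
      simp only [LinearMap.smul_apply, form_apply, smul_eq_mul, LinearMap.zero_apply] at h
      rw [SetLike.mem_coe, Submodule.mem_comap, hψ]
      simp only [← map_mul]
      rw [← map_sum, h, map_zero]
      exact P.zero_mem
    · rw [SetLike.mem_coe, Submodule.mem_comap, hψ]
      refine P.sum_mem fun i _ => P.mul_mem_left _ ?_
      by_cases h : (i : ι) = j
      · rw [← h, Pi.single_eq_same]
        exact i.2
      · rw [Pi.single_eq_of_ne h]
        exact P.zero_mem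
  intro a ha
  have h1 := Module.mem_annihilator.1 ha ((relations W).mkQ (Pi.single i₀ 1))
  rw [← map_smul, Submodule.mkQ_apply, Submodule.Quotient.mk_eq_zero, ← Pi.single_smul,
    smul_eq_mul, mul_one] at h1
  have h2 : ψ (Pi.single i₀ a) ∈ P := hle h1
  rw [hψ, Finset.sum_eq_single i₀ (fun i _ hi => by
    rw [Pi.single_eq_of_ne (fun h => hi (Subtype.ext h)), mul_zero]) (by simp),
    Pi.single_eq_same] at h2
  refine (hP.mem_or_mem h2).resolve_left fun h3 => hP.ne_top ?_
  exact P.eq_top_of_isUnit_mem h3 ((isUnit_iff_ne_zero.2 hi₀).map _)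

/-- The support of `(S/𝔞)_(·,1)` consists of the primes `P` for which the set of all `i` with
`f_i ∈ P` is dependent. -/
theorem annihilator_le_iff (hW : IsRealization M W) {P : Ideal (CoordRing W)} [P.IsPrime] :
    Module.annihilator (CoordRing W) (Coker W) ≤ P ↔ M.Dep {i | coord W i ∈ P} := by
  rw [← Matroid.not_indep_iff (by simp [hW.ground_eq])]
  exact ⟨fun h hI => hW.not_annihilator_le hI h, hW.annihilator_le⟩

theorem eq_flatIdeal_of_mem_associatedPrimes (hW : IsRealization M W) {P : Ideal (CoordRing W)}
    (hP : P ∈ associatedPrimes (CoordRing W) (Coker W)) :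
    P = flatIdeal W {i | coord W i ∈ P} := by
  have := hW.isNoetherianRing
  obtain ⟨hprime, x, hx⟩ := isAssociatedPrime_iff.1 hP
  obtain ⟨v, rfl⟩ := (relations W).mkQ_surjective x
  replace hx : ∀ b, b ∈ P ↔ b • v ∈ relations W := by
    intro b
    rw [hx, Submodule.mem_colon_singleton, Submodule.mem_bot, ← map_smul, Submodule.mkQ_apply,
      Submodule.Quotient.mk_eq_zero]
  set F := {i | coord W i ∈ P} with hF
  have hFP : flatIdeal W F ≤ P := by
    rw [flatIdeal, Ideal.span_le]
    rintro _ ⟨i, hi, rfl⟩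
    exact hi
  refine le_antisymm (fun b hb => ?_) hFP
  obtain ⟨u, huP, hu⟩ := exists_notMem_single_mem_relations P
  obtain ⟨I, T, hIF, e, he, heF⟩ := hW.exists_polynomial_equiv F
  rw [flatIdeal_eq_comap hIF he heF]
  -- Vectors over the small ring that become relations after multiplication by `u`. Its extension
  -- lies between `relations W` and the vectors that `u` carries into `relations W`; as `u ∉ P`, it
  -- still misses `v`.
  let L : Submodule (MvPolynomial I k) (ι → MvPolynomial I k) :=
    { carrier := {z | u • (fun i => e.symm (C (z i))) ∈ relations W}
      zero_mem' := by
        have : (fun i : ι => e.symm (C ((0 : ι → MvPolynomial I k) i))) = 0 := by ext; simp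
        rw [Set.mem_ofPred_eq, this, smul_zero]
        exact Submodule.zero_mem _
      add_mem' := fun {a b} ha hb => by
        have : (fun i : ι => e.symm (C ((a + b) i))) =
            (fun i => e.symm (C (a i))) + fun i => e.symm (C (b i)) := by ext; simp
        rw [Set.mem_ofPred_eq, this, smul_add]
        exact Submodule.add_mem _ ha hb
      smul_mem' := fun c a ha => by
        have : (fun i : ι => e.symm (C ((c • a) i))) =
            e.symm (C c) • fun i => e.symm (C (a i)) := by ext; simp
        rw [Set.mem_ofPred_eq, this, smul_comm]
        exact Submodule.smul_mem _ _ ha }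
  have hL : ∀ z, z ∈ L ↔ u • (fun i => e.symm (C (z i))) ∈ relations W := fun z => Iff.rfl
  have hsingle : ∀ (i : ι) (a : MvPolynomial I k),
      (fun j => e.symm (C ((Pi.single i a : ι → MvPolynomial I k) j))) =
        Pi.single i (e.symm (C a)) := by
    intro i a
    ext j
    by_cases h : j = i
    · subst h; simp
    · simp [h]
  have hext : extend e.toRingEquiv L ≤ (relations W).comap (LinearMap.lsmul _ _ u) := by
    rw [extend, Submodule.span_le]
    rintro _ ⟨z, hz, rfl⟩
    exact (hL z).1 hz
  have hrel : relations W ≤ extend e.toRingEquiv L := by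
    rw [relations, Submodule.span_le]
    rintro _ (⟨w, hw⟩ | j)
    · have h : (fun i => e.symm (C (C (w i)))) = fun i => algebraMap k (CoordRing W) (w i) := by
        ext i
        rw [AlgEquiv.symm_apply_eq, AlgEquiv.commutes]
        rfl
      refine Submodule.subset_span ⟨fun i => C (w i), (hL _).2 ?_, h⟩
      rw [h]
      exact Submodule.smul_mem _ _ (const_mem_relations hw)
    · by_cases hj : j ∈ F
      · obtain ⟨l, -, hl⟩ := heF j hj
        have h : (fun i => e.symm (C ((Pi.single j l : ι → MvPolynomial I k) i))) =
            Pi.single j (coord W j) := by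
          rw [hsingle, ← hl, AlgEquiv.symm_apply_apply]
        refine Submodule.subset_span ⟨Pi.single j l, (hL _).2 ?_, h⟩
        rw [h]
        exact Submodule.smul_mem _ _ (single_mem_relations W j)
      -- For `j ∉ F` the form `f_j` need not come from the small ring, but `u` already kills `e_j`
      -- itself.
      · have h : (fun i => e.symm (C ((Pi.single j 1 : ι → MvPolynomial I k) i))) =
            Pi.single j 1 := by
          rw [hsingle, C_1, map_one]
        have h1 : Pi.single j 1 ∈ extend e.toRingEquiv L := by
          refine Submodule.subset_span ⟨Pi.single j 1, (hL _).2 ?_, h⟩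
          rw [h, ← Pi.single_smul, smul_eq_mul, mul_one]
          exact hu j hj
        rw [← mul_one (coord W j), ← smul_eq_mul, Pi.single_smul]
        exact Submodule.smul_mem _ _ h1
  -- Any order on the finite set of variables will do; it only supplies the lexicographic order.
  let _ : LinearOrder T := LinearOrder.lift' (Finite.equivFin T) (Finite.equivFin T).injective
  refine mem_map_C_of_smul_mem_extend e.toRingEquiv (idealOfVars I k) L (v := v)
    (fun h => huP ((hx u).2 (hext h))) (fun a ha => hrel ((hx _).1 (hFP ?_)))
    (hrel ((hx b).1 hb))
  rw [flatIdeal_eq_comap hIF he heF, Ideal.mem_comap]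
  change e (e.symm (C a)) ∈ _
  rw [AlgEquiv.apply_symm_apply]
  exact Ideal.mem_map_of_mem _ ha

theorem associatedPrimes_subset (hW : IsRealization M W) :
    associatedPrimes (CoordRing W) (Coker W) ⊆
      {P | ∃ F : Set ι, F.Nonempty ∧ M.IsFlat F ∧ P = flatIdeal W F} := by
  intro P hP
  have hprime : P.IsPrime := IsAssociatedPrime.isPrime hP
  exact ⟨_, (hW.annihilator_le_iff.1
    (Submodule.annihilator_top.symm.le.trans (IsAssociatedPrime.annihilator_le hP))).nonempty,
    hW.isFlat_setOf_coord_mem P, hW.eq_flatIdeal_of_mem_associatedPrimes hP⟩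

theorem annihilator_le_flatIdeal (hW : IsRealization M W) {F : Set ι} (hF : IsCyclicFlat M F)
    (hne : F.Nonempty) : Module.annihilator (CoordRing W) (Coker W) ≤ flatIdeal W F := by
  have := hW.isPrime_flatIdeal F
  rw [hW.annihilator_le_iff, hW.setOf_coord_mem_flatIdeal hF.1]
  exact hF.dep hne

theorem exists_isCyclicFlat_subset (hW : IsRealization M W) {P : Ideal (CoordRing W)} [P.IsPrime]
    (hP : Module.annihilator (CoordRing W) (Coker W) ≤ P) :
    ∃ F ⊆ {i | coord W i ∈ P}, IsCyclicFlat M F ∧ F.Nonempty := by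
  obtain ⟨C, hCP, hC⟩ := (hW.annihilator_le_iff.1 hP).exists_isCircuit_subset
  exact ⟨M.closure C, (M.closure_subset_closure hCP).trans (hW.isFlat_setOf_coord_mem P).closure.subset,
    isCyclicFlat_closure hC, hC.nonempty.mono (M.subset_closure C hC.subset_ground)⟩

theorem moduleMinimalPrimes_coker (hW : IsRealization M W) :
    moduleMinimalPrimes (CoordRing W) (Coker W) =
      {P | ∃ F : Set ι, Minimal (fun G => IsCyclicFlat M G ∧ G.Nonempty) F ∧
        P = flatIdeal W F} := by
  ext P
  constructor
  · rintro ⟨⟨hprime, hann⟩, hmin⟩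
    obtain ⟨F, hFP, hF, hne⟩ := hW.exists_isCyclicFlat_subset hann
    have key : ∀ G, IsCyclicFlat M G → G.Nonempty → G ⊆ F → P = flatIdeal W G := by
      intro G hG hGne hGF
      have hle := flatIdeal_le_iff.2 (hGF.trans hFP)
      exact (hmin ⟨hW.isPrime_flatIdeal G, hW.annihilator_le_flatIdeal hG hGne⟩ hle).antisymm hle
    refine ⟨F, ⟨⟨hF, hne⟩, fun G hG hGF => ?_⟩, key F hF hne subset_rfl⟩
    -- Since `P = P_G` and a flat is recovered from its ideal, `F ⊆ G`.
    rw [key G hG.1 hG.2 hGF, hW.setOf_coord_mem_flatIdeal hG.1.1] at hFP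
    exact hFP
  · rintro ⟨F, ⟨⟨hF, hne⟩, hmin⟩, rfl⟩
    refine ⟨⟨hW.isPrime_flatIdeal F, hW.annihilator_le_flatIdeal hF hne⟩, ?_⟩
    rintro Q ⟨hprime, hann⟩ hQ
    obtain ⟨G, hGQ, hG⟩ := hW.exists_isCyclicFlat_subset hann
    refine flatIdeal_le_iff.2 ((hmin hG fun i hi => ?_).trans hGQ)
    exact (hW.coord_mem_flatIdeal_iff hF.1).1 (hQ (hGQ hi))

end IsRealization

end IdealOfPairs
end

theorem corollary3p10 {k : Type*} [Field k] (n : ℕ) (M : Matroid (Fin n))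
    (W : Submodule k (Fin n → k)) (hW : IdealOfPairs.IsRealization M W)
    (hloop : ∀ i, ¬ M.IsLoop i) (hcoloop : ∀ i, ¬ M.IsColoop i) :
    associatedPrimes (IdealOfPairs.CoordRing W) (IdealOfPairs.quotSlice W 1) ⊆
        {P | ∃ F : Set (Fin n), F.Nonempty ∧ M.IsFlat F ∧ P = IdealOfPairs.flatIdeal W F} ∧
      IdealOfPairs.moduleMinimalPrimes (IdealOfPairs.CoordRing W) (IdealOfPairs.quotSlice W 1) =
        {P | ∃ F : Set (Fin n),
          Minimal (fun G => IdealOfPairs.IsCyclicFlat M G ∧ G.Nonempty) F ∧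
            P = IdealOfPairs.flatIdeal W F} := by
  have e := IdealOfPairs.cokerEquiv W
  rw [← LinearEquiv.AssociatedPrimes.eq e, IdealOfPairs.moduleMinimalPrimes, ← e.annihilator_eq]
  exact ⟨hW.associatedPrimes_subset, hW.moduleMinimalPrimes_coker⟩
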